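/- Let $n\ge 0$. A simplicial $n$-complex is a nonempty family $\mathcal K$ of finite nonempty sets (faces), closed under taking nonempty subsets, such that no face has more than $n+1$ elements and every face lies in an $n$-face; a $k$-face is a face with $k+1$ elements, and the empty set is counted as the unique $(-1)$-face. Call $\mathcal K$ a closed pseudomanifold if every $(n-1)$-face lies in exactly two $n$-faces and any two $n$-faces are joined by a finite sequence of $n$-faces in which consecutive ones share an $(n-1)$-face. The link of an $(n-2)$-face $F$ is the graph formed by all two-element sets $e$ disjoint from $F$ such that $F\cup e$ is an $n$-face. Say that $\mathcal K$ is of type $\{3,4\}$ if it is a closed pseudomanifold and the link of each $(n-2)$-face is a single cycle of length $3$ or $4$ (it is not required that both lengths occur). **Theorem.** Every $n$-dimensional simplicial complex $\mathcal K$ of type $\{3,4\}$ is spherical: its geometric realization $|\mathcal K|$ is homeomorphic to the unit sphere $S^n\subset\mathbb R^{n+1}$. -/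

import Mathlib

namespace PreAbstractSimplicialComplex

/-! ### Geometric realization -/

section Realization

variable {V : Type*}

/-- The closed geometric simplex spanned by a finite set `s` of vertices, in barycentric
coordinates: nonnegative functions on `V`, vanishing outside `s`, with coordinate sum `1`. -/
def closedSimplex (s : Finset V) : Set (V → ℝ) :=
  {x | (∀ v, 0 ≤ x v) ∧ (∀ v, v ∉ s → x v = 0) ∧ ∑ v ∈ s, x v = 1}

/-- The underlying set of the geometric realization: the union of the closed simplices spanned
by the faces. -/
def realizationSet (K : PreAbstractSimplicialComplex V) : Set (V → ℝ) :=
  ⋃ s ∈ K.faces, closedSimplex s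

/-- The geometric realization `|K|`. Its topology is the usual coherent (weak) one, given below;
it is not, for infinite `K`, the topology induced from `V → ℝ`. -/
def Realization (K : PreAbstractSimplicialComplex V) : Type _ :=
  ↥(realizationSet K)

/-- The inclusion of the closed simplex of a face into the geometric realization. -/
def simplexInclusion (K : PreAbstractSimplicialComplex V) (s : K.faces) :
    ↥(closedSimplex (s : Finset V)) → Realization K :=
  fun x => ⟨x.1, Set.mem_biUnion s.2 x.2⟩

/-- A subset of `|K|` is open iff its trace on the closed simplex of every face is open, where each
(finite-dimensional) closed simplex carries its Euclidean topology. -/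
instance (K : PreAbstractSimplicialComplex V) : TopologicalSpace (Realization K) :=
  ⨆ s : K.faces, TopologicalSpace.coinduced (simplexInclusion K s) inferInstance

end Realization

/-! ### Simplicial complexes of type `L` -/

section Types

variable {V : Type*} [DecidableEq V]

/-- The faces of `K`, together with the empty set as the unique face of dimension `-1`. -/
def augmentedFaces (K : PreAbstractSimplicialComplex V) : Set (Finset V) :=
  insert ∅ K.faces

/-- `T` is an `n`-face of `K`: a face with `n + 1` vertices. -/
def IsTopFace (K : PreAbstractSimplicialComplex V) (n : ℕ) (T : Finset V) : Prop :=
  T ∈ K.faces ∧ T.card = n + 1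

/-- `K` is a simplicial `n`-complex: it is nonempty, and all its maximal faces have `n + 1`
vertices (every face lies in an `n`-face, and no face has more than `n + 1` vertices). -/
structure IsPure (K : PreAbstractSimplicialComplex V) (n : ℕ) : Prop where
  nonempty : K.faces.Nonempty
  card_le : ∀ s ∈ K.faces, s.card ≤ n + 1
  exists_topFace : ∀ s ∈ K.faces, ∃ T, K.IsTopFace n T ∧ s ⊆ T

/-- Two `n`-faces are adjacent if they share an `(n - 1)`-face. -/
def TopFaceAdj (K : PreAbstractSimplicialComplex V) (n : ℕ) (S T : Finset V) : Prop :=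
  K.IsTopFace n S ∧ K.IsTopFace n T ∧ (S ∩ T).card = n

/-- `K` is an `n`-dimensional closed pseudomanifold. -/
structure IsClosedPseudomanifold (K : PreAbstractSimplicialComplex V) (n : ℕ) : Prop where
  pure : K.IsPure n
  /-- every `(n - 1)`-face lies in exactly two `n`-faces -/
  closed : ∀ F ∈ K.augmentedFaces, F.card = n → {T | K.IsTopFace n T ∧ F ⊆ T}.ncard = 2
  /-- any two `n`-faces are joined by a chain of successively adjacent `n`-faces -/
  stronglyConnected : ∀ S T, K.IsTopFace n S → K.IsTopFace n T →
    Relation.ReflTransGen (K.TopFaceAdj n) S T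

/-- The link of an `(n - 2)`-face `F` of a simplicial `n`-complex, as a graph: its vertices are the
`v ∉ F` such that `F ∪ {v}` is a face, and its edges are the pairs `e = {v, w}` such that
`F ∪ e` is an (`n`-)face. -/
def linkGraph (K : PreAbstractSimplicialComplex V) (F : Finset V) :
    SimpleGraph {v : V // v ∉ F ∧ insert v F ∈ K.faces} where
  Adj v w := v ≠ w ∧ insert v.1 (insert w.1 F) ∈ K.faces
  symm := ⟨fun v w h => ⟨h.1.symm, by rw [Finset.insert_comm]; exact h.2⟩⟩
  loopless := ⟨fun _ h => h.1 rfl⟩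

/-- `l(F) = k`: the link of `F` is a single cycle, of length `k`. -/
def HasLinkLength (K : PreAbstractSimplicialComplex V) (F : Finset V) (k : ℕ) : Prop :=
  Nonempty (K.linkGraph F ≃g SimpleGraph.cycleGraph k)

/-- `K` is an `n`-dimensional closed simplicial complex of type `L`: each of its `(n - 2)`-faces `F`
has a link consisting of a single cycle whose length `l(F)` belongs to `L`. It is not required that
all elements of `L` occur. -/
structure IsOfType (K : PreAbstractSimplicialComplex V) (n : ℕ) (L : Set ℕ) : Prop where
  closedPseudomanifold : K.IsClosedPseudomanifold n
  linkLength : ∀ F ∈ K.augmentedFaces, F.card + 1 = n → ∃ k ∈ L, K.HasLinkLength F k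

end Types

end PreAbstractSimplicialComplex

/-!
A complex `K` of type `{3, 4}` is a join of boundaries of simplices, and such a join is a sphere.

*Combinatorics.* Fix an `n`-face `T`, and for `v ∈ T` let `c v` be the vertex opposite to `v`: the
one replacing `v` in the other `n`-face through the ridge `T \ {v}`. Put `c v = v` for `v ∉ T`. The
fibres of `c` on `U = T ∪ c(T)` are called blocks, and `T` misses exactly one vertex of each block.
Both this property and the fact that opposite vertices lie in the same block persist under passing
to a neighbouring `n`-face (`IsBlockFace.flip`). The only step that is not formal is that the flips
across two ridges `S \ {v}` and `S \ {w}`, introducing distinct vertices `x` and `q`, commute: the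
link of `S \ {v, w}` contains the path `x, w, v, q`, and as it is a cycle of length at most `4`, it
also contains the edge `{x, q}` (`IsOfType.isTopFace_flip_flip`). By strong connectivity all
`n`-faces are compatible with the blocks, and it follows that the faces are exactly the nonempty
subsets of `U` that contain no block (`IsOfType.exists_blocks`).

*Topology.* A vector `(z v)` on `U`, taken up to adding constants on each block, has a unique
representative with minimum `0` on each block, that is, a nonnegative representative whose support
contains no block. The differences `x v - x (c v)`, `v ∈ T`, are coordinates on the
`(n + 1)`-dimensional space of such classes, so that they map `|K|` bijectively onto a set meeting
each open ray from the origin exactly once. Normalising yields a continuous bijection from the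
compact space `|K|` to the unit sphere (`nonempty_homeomorph_sphere_of_blocks`).
-/

namespace PreAbstractSimplicialComplex

/-! ### Flips across ridges -/

section Flips

variable {V : Type*} {K : PreAbstractSimplicialComplex V} {n : ℕ}

theorem mem_augmentedFaces_of_subset {s t : Finset V} (ht : t ∈ K.faces) (hst : s ⊆ t) :
    s ∈ K.augmentedFaces := by
  rcases s.eq_empty_or_nonempty with rfl | hs
  · exact Set.mem_insert _ _
  · exact Set.mem_insert_of_mem _ ((K.isRelLowerSet_faces ht).2 hst hs)

variable [DecidableEq V]

/-- Across each of its ridges, an `n`-face of a closed pseudomanifold has exactly one neighbour. -/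
theorem IsClosedPseudomanifold.exists_unique_flip (hK : K.IsClosedPseudomanifold n)
    {S : Finset V} (hS : K.IsTopFace n S) {v : V} (hv : v ∈ S) :
    ∃ x, x ∉ S ∧ K.IsTopFace n (insert x (S.erase v)) ∧
      ∀ y, y ∉ S → K.IsTopFace n (insert y (S.erase v)) → y = x := by
  have hcard : (S.erase v).card = n := by rw [Finset.card_erase_of_mem hv, hS.2]; rfl
  have h2 := hK.closed (S.erase v)
    (mem_augmentedFaces_of_subset hS.1 (S.erase_subset v)) hcard
  have hmem : S ∈ {T | K.IsTopFace n T ∧ S.erase v ⊆ T} := ⟨hS, S.erase_subset v⟩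
  obtain ⟨T, hT, hTu⟩ : ∃ T, (K.IsTopFace n T ∧ S.erase v ⊆ T ∧ T ≠ S) ∧
      ∀ T', K.IsTopFace n T' → S.erase v ⊆ T' → T' ≠ S → T' = T := by
    obtain ⟨A, B, hAB, hset⟩ := Set.ncard_eq_two.1 h2
    have hiff : ∀ R, (K.IsTopFace n R ∧ S.erase v ⊆ R) ↔ R = A ∨ R = B := fun R => by
      simpa using Set.ext_iff.1 hset R
    rcases (hiff S).1 hmem with rfl | rfl
    · exact ⟨B, ⟨((hiff B).2 (Or.inr rfl)).1, ((hiff B).2 (Or.inr rfl)).2, hAB.symm⟩,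
        fun R h1 h3 h4 => ((hiff R).1 ⟨h1, h3⟩).resolve_left h4⟩
    · exact ⟨A, ⟨((hiff A).2 (Or.inl rfl)).1, ((hiff A).2 (Or.inl rfl)).2, hAB⟩,
        fun R h1 h3 h4 => ((hiff R).1 ⟨h1, h3⟩).resolve_right h4⟩
  obtain ⟨x, hx, rfl⟩ := Finset.exists_eq_insert_iff.2
    ⟨hT.2.1, show (S.erase v).card + 1 = T.card by rw [hcard, hT.1.2]⟩
  have hxv : x ≠ v := by
    rintro rfl
    exact hT.2.2 (Finset.insert_erase hv)
  refine ⟨x, fun h => hx (Finset.mem_erase.2 ⟨hxv, h⟩), hT.1, fun y hy hyT => ?_⟩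
  have h := hTu _ hyT (Finset.subset_insert _ _)
    fun h => hy (h ▸ Finset.mem_insert_self y (S.erase v))
  have : y ∈ insert x (S.erase v) := h ▸ Finset.mem_insert_self y (S.erase v)
  rcases Finset.mem_insert.1 this with h | h
  · exact h
  · exact absurd (Finset.mem_of_mem_erase h) hy

theorem TopFaceAdj.exists_flip {S T : Finset V} (h : K.TopFaceAdj n S T) :
    ∃ v ∈ S, ∃ x, x ∉ S ∧ T = insert x (S.erase v) := by
  obtain ⟨hS, hT, hc⟩ := h
  obtain ⟨v, hv, hvS⟩ := Finset.exists_eq_insert_iff.2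
    ⟨Finset.inter_subset_left (s₁ := S) (s₂ := T), by rw [hc, hS.2]⟩
  obtain ⟨x, hx, hxT⟩ := Finset.exists_eq_insert_iff.2
    ⟨Finset.inter_subset_right (s₁ := S) (s₂ := T), by rw [hc, hT.2]⟩
  refine ⟨v, hvS ▸ Finset.mem_insert_self _ _, x,
    fun h => hx (Finset.mem_inter.2 ⟨h, hxT ▸ Finset.mem_insert_self _ _⟩), ?_⟩
  have : S.erase v = S ∩ T := by
    conv_lhs => rw [← hvS]
    exact Finset.erase_insert hv
  rw [this, hxT]

/-- In a cycle of length `3` or `4`, a path through four distinct vertices closes up. -/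
theorem cycleGraph_adj_of_path {k : ℕ} (hk : k ∈ ({3, 4} : Set ℕ)) {a b c d : Fin k}
    (hab : (SimpleGraph.cycleGraph k).Adj a b) (hbc : (SimpleGraph.cycleGraph k).Adj b c)
    (hcd : (SimpleGraph.cycleGraph k).Adj c d) (hac : a ≠ c) (hbd : b ≠ d) (had : a ≠ d) :
    (SimpleGraph.cycleGraph k).Adj a d := by
  rw [SimpleGraph.cycleGraph_adj'] at *
  rcases hk with rfl | hk
  · revert a b c d; decide
  · obtain rfl : k = 4 := hk
    revert a b c d; decide

/-- Flips of an `n`-face across two ridges commute, unless they introduce the same vertex. This is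
where the length of the links is used: the link of the common `(n - 2)`-face contains the path
`x, w, v, q`. -/
theorem IsOfType.isTopFace_flip_flip (hK : K.IsOfType n {3, 4}) {S : Finset V}
    (hS : K.IsTopFace n S) {v w x q : V} (hv : v ∈ S) (hw : w ∈ S) (hwv : w ≠ v)
    (hx : x ∉ S) (hq : q ∉ S) (hqx : q ≠ x) (hxS : K.IsTopFace n (insert x (S.erase v)))
    (hqS : K.IsTopFace n (insert q (S.erase w))) :
    K.IsTopFace n (insert q ((insert x (S.erase v)).erase w)) := by
  set F := (S.erase v).erase w with hF
  have hwF : w ∈ S.erase v := Finset.mem_erase.2 ⟨hwv, hw⟩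
  have hvF : v ∈ S.erase w := Finset.mem_erase.2 ⟨hwv.symm, hv⟩
  have hF' : F = (S.erase w).erase v := Finset.erase_right_comm
  have hFS : F ⊆ S := (Finset.erase_subset _ _).trans (Finset.erase_subset _ _)
  have hcard : F.card + 1 = n := by
    have h1 : F.card + 1 = _ := Finset.card_erase_add_one hwF
    have h2 := Finset.card_erase_add_one hv
    have h3 := hS.2
    omega
  have ewF : insert w F = S.erase v := Finset.insert_erase hwF
  have evF : insert v F = S.erase w := by rw [hF', Finset.insert_erase hvF]
  have hxw : x ≠ w := fun h => hx (h ▸ hw)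
  have hxv : x ≠ v := fun h => hx (h ▸ hv)
  have hqw : q ≠ w := fun h => hq (h ▸ hw)
  have hqv : q ≠ v := fun h => hq (h ▸ hv)
  have hface : ∀ {z : V} {T : Finset V}, T ∈ K.faces → insert z F ⊆ T → insert z F ∈ K.faces :=
    fun hT h => (K.isRelLowerSet_faces hT).2 h (Finset.insert_nonempty _ _)
  have fxw : insert x (insert w F) ∈ K.faces := by rw [ewF]; exact hxS.1
  have fwv : insert w (insert v F) ∈ K.faces := by rw [evF, Finset.insert_erase hw]; exact hS.1
  have fvq : insert v (insert q F) ∈ K.faces := by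
    rw [Finset.insert_comm, evF]; exact hqS.1
  obtain ⟨k, hk, ⟨e⟩⟩ := hK.linkLength F (mem_augmentedFaces_of_subset hS.1 hFS) hcard
  let x' : {v : V // v ∉ F ∧ insert v F ∈ K.faces} := ⟨x, fun h => hx (hFS h),
    hface fxw (Finset.insert_subset_insert _ (Finset.subset_insert _ _))⟩
  let w' : {v : V // v ∉ F ∧ insert v F ∈ K.faces} := ⟨w, Finset.notMem_erase _ _,
    hface fwv (Finset.insert_subset_insert _ (Finset.subset_insert _ _))⟩
  let v' : {v : V // v ∉ F ∧ insert v F ∈ K.faces} := ⟨v, hF' ▸ Finset.notMem_erase _ _,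
    hface fvq (Finset.insert_subset_insert _ (Finset.subset_insert _ _))⟩
  let q' : {v : V // v ∉ F ∧ insert v F ∈ K.faces} := ⟨q, fun h => hq (hFS h),
    hface fvq (Finset.subset_insert _ _)⟩
  have a1 : (K.linkGraph F).Adj x' w' := ⟨fun h => hxw (congrArg Subtype.val h), fxw⟩
  have a2 : (K.linkGraph F).Adj w' v' := ⟨fun h => hwv (congrArg Subtype.val h), fwv⟩
  have a3 : (K.linkGraph F).Adj v' q' :=
    ⟨fun h => hqv.symm (congrArg Subtype.val h), fvq⟩
  have a4 : (K.linkGraph F).Adj x' q' := e.map_adj_iff.1 <|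
    cycleGraph_adj_of_path hk (e.map_adj_iff.2 a1) (e.map_adj_iff.2 a2) (e.map_adj_iff.2 a3)
      (e.injective.ne fun h => hxv (congrArg Subtype.val h))
      (e.injective.ne fun h => hqw.symm (congrArg Subtype.val h))
      (e.injective.ne fun h => hqx.symm (congrArg Subtype.val h))
  have hset : insert q ((insert x (S.erase v)).erase w) = insert x (insert q F) := by
    rw [Finset.erase_insert_of_ne hxw, Finset.insert_comm]
  refine ⟨hset ▸ a4.2, ?_⟩
  rw [hset, Finset.card_insert_of_notMem, Finset.card_insert_of_notMem q'.2.1, hcard]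
  simpa [hqx.symm] using x'.2.1

end Flips

/-! ### The decomposition into blocks -/

section Blocks

variable {V : Type*} [DecidableEq V] {K : PreAbstractSimplicialComplex V} {n : ℕ}

/-- `S` is an `n`-face of `K` that is compatible with the partition of the finite vertex set `U`
into blocks, the fibres of `c`: it misses exactly one vertex of each block, and the vertex opposite
to `v ∈ S` (the one replacing `v` in the neighbouring `n`-face) is the missing vertex of the block
of `v`. -/
structure IsBlockFace (K : PreAbstractSimplicialComplex V) (n : ℕ) (U : Finset V) (c : V → V)
    (S : Finset V) : Prop where
  isTopFace : K.IsTopFace n S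
  subset : S ⊆ U
  injOn : ∀ x ∈ U, x ∉ S → ∀ y ∈ U, y ∉ S → c x = c y → x = y
  exists_missing : ∀ v ∈ U, ∃ u ∈ U, u ∉ S ∧ c u = c v
  opposite : ∀ v ∈ S, ∀ x ∉ S, K.IsTopFace n (insert x (S.erase v)) → x ∈ U ∧ c x = c v

/-- Neighbouring `n`-faces determine the same blocks. -/
theorem IsBlockFace.flip (hK : K.IsOfType n {3, 4}) {U : Finset V} {c : V → V} {S : Finset V}
    (h : K.IsBlockFace n U c S) {v x : V} (hv : v ∈ S) (hx : x ∉ S)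
    (hxS : K.IsTopFace n (insert x (S.erase v))) :
    K.IsBlockFace n U c (insert x (S.erase v)) := by
  obtain ⟨hxU, hcx⟩ := h.opposite v hv x hx hxS
  have hvU := h.subset hv
  have hxv : x ≠ v := fun e => hx (e ▸ hv)
  have hmem : ∀ y, y ∉ insert x (S.erase v) ↔ y = v ∨ (y ∉ S ∧ y ≠ x) := by
    intro y
    by_cases hyv : y = v
    · subst hyv; simp [hxv.symm]
    · simp [hyv, and_comm]
  refine ⟨hxS, Finset.insert_subset hxU ((Finset.erase_subset _ _).trans h.subset), ?_, ?_, ?_⟩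
  · intro y hyU hy z hzU hz hyz
    rcases (hmem y).1 hy with rfl | ⟨hy', hyx⟩ <;> rcases (hmem z).1 hz with rfl | ⟨hz', hzx⟩
    · rfl
    · exact absurd (h.injOn z hzU hz' x hxU hx (hyz.symm.trans hcx.symm)) hzx
    · exact absurd (h.injOn y hyU hy' x hxU hx (hyz.trans hcx.symm)) hyx
    · exact h.injOn y hyU hy' z hzU hz' hyz
  · intro w hw
    obtain ⟨u, huU, hu, hcu⟩ := h.exists_missing w hw
    by_cases hux : u = x
    · exact ⟨v, hvU, (hmem v).2 (Or.inl rfl), by rw [← hcu, hux, hcx]⟩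
    · exact ⟨u, huU, (hmem u).2 (Or.inr ⟨hu, hux⟩), hcu⟩
  · intro w hw y hy hyS
    rcases Finset.mem_insert.1 hw with rfl | hwS
    · -- Flipping back across the same ridge.
      rw [Finset.erase_insert fun h' => hx (Finset.mem_of_mem_erase h')] at hyS
      rcases (hmem y).1 hy with rfl | ⟨hy, -⟩
      · exact ⟨hvU, hcx.symm⟩
      · rw [hcx]
        exact h.opposite v hv y hy hyS
    · obtain ⟨hwv, hwS⟩ := Finset.mem_erase.1 hwS
      obtain ⟨p, -, -, hp⟩ := hK.closedPseudomanifold.exists_unique_flip hxS hw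
      obtain ⟨q, hq, hqS, -⟩ := hK.closedPseudomanifold.exists_unique_flip h.isTopFace hwS
      obtain ⟨hqU, hcq⟩ := h.opposite w hwS q hq hqS
      have hyp := hp y hy hyS
      by_cases hqx : q = x
      · -- `v` and `w` lie in the same block, and `v` is opposite to `w` after the flip.
        subst hqx
        have hset : insert v ((insert q (S.erase v)).erase w) = insert q (S.erase w) := by
          have hqw : q ≠ w := fun e => hq (e ▸ hwS)
          rw [Finset.erase_insert_of_ne hqw, Finset.insert_comm,
            Finset.erase_right_comm, Finset.insert_erase (Finset.mem_erase.2 ⟨hwv.symm, hv⟩)]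
        have := hp v ((hmem v).2 (Or.inl rfl)) (hset ▸ hqS)
        rw [hyp, ← this]
        exact ⟨hvU, hcx.symm.trans hcq⟩
      · have := hp q ((hmem q).2 (Or.inr ⟨hq, hqx⟩))
          (hK.isTopFace_flip_flip h.isTopFace hv hwS hwv hx hq hqx hxS hqS)
        rw [hyp, ← this]
        exact ⟨hqU, hcq⟩

/-- A complex of type `{3, 4}` is a join of boundaries of simplices: its faces are the nonempty sets
of vertices that contain none of the blocks, the fibres of `c` on `T ∪ T.image c`. Here `T` is an
`n`-face and `c` sends a vertex of `T` to the opposite vertex. -/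
theorem IsOfType.exists_blocks (hK : K.IsOfType n {3, 4}) :
    ∃ (T : Finset V) (c : V → V), T.card = n + 1 ∧ (∀ v ∈ T, c v ∉ T) ∧ (∀ v ∉ T, c v = v) ∧
      ∀ s, s ∈ K.faces ↔ s.Nonempty ∧ s ⊆ T ∪ T.image c ∧
        ∀ v ∈ T ∪ T.image c, ∃ u ∈ T ∪ T.image c, u ∉ s ∧ c u = c v := by
  have hP := hK.closedPseudomanifold
  obtain ⟨s₀, hs₀⟩ := hP.pure.nonempty
  obtain ⟨T, hT, -⟩ := hP.pure.exists_topFace s₀ hs₀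
  have hex : ∀ v, ∃ x, (v ∈ T → x ∉ T ∧ ∀ y ∉ T, K.IsTopFace n (insert y (T.erase v)) → y = x) ∧
      (v ∉ T → x = v) := by
    intro v
    by_cases hv : v ∈ T
    · obtain ⟨x, hx, -, hu⟩ := hP.exists_unique_flip hT hv
      exact ⟨x, fun _ => ⟨hx, hu⟩, fun h => absurd hv h⟩
    · exact ⟨v, fun h => absurd h hv, fun _ => rfl⟩
  choose c hcT hc using hex
  set U := T ∪ T.image c with hU
  have hUc : ∀ v ∈ U, v ∉ T → ∃ t ∈ T, c t = v := fun v hv hvT =>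
    Finset.mem_image.1 ((Finset.mem_union.1 hv).resolve_left hvT)
  have hcU : ∀ v ∈ T, c v ∈ U := fun v hv =>
    Finset.mem_union_right _ (Finset.mem_image_of_mem _ hv)
  have hbase : K.IsBlockFace n U c T := by
    refine ⟨hT, Finset.subset_union_left, ?_, ?_, ?_⟩
    · intro x _ hx y _ hy hxy
      rwa [hc x hx, hc y hy] at hxy
    · intro v hv
      by_cases hvT : v ∈ T
      · exact ⟨c v, hcU v hvT, (hcT v hvT).1, hc _ (hcT v hvT).1⟩
      · exact ⟨v, hv, hvT, rfl⟩
    · intro v hv x hx hxS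
      obtain rfl := (hcT v hv).2 x hx hxS
      exact ⟨hcU v hv, hc _ hx⟩
  have hall : ∀ S, K.IsTopFace n S → K.IsBlockFace n U c S := by
    intro S hS
    induction hP.stronglyConnected T S hT hS with
    | refl => exact hbase
    | tail _ hadj ih =>
      obtain ⟨v, hv, x, hx, rfl⟩ := hadj.exists_flip
      exact (ih hadj.1).flip hK hv hx hadj.2.1
  refine ⟨T, c, hT.2, fun v hv => (hcT v hv).1, hc, fun s => ⟨fun hs => ?_, ?_⟩⟩
  · obtain ⟨S, hS, hsS⟩ := hP.pure.exists_topFace s hs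
    have hB := hall S hS
    refine ⟨(K.isRelLowerSet_faces hs).1, hsS.trans hB.subset, fun v hv => ?_⟩
    obtain ⟨u, hu, huS, hcu⟩ := hB.exists_missing v hv
    exact ⟨u, hu, fun h => huS (hsS h), hcu⟩
  · rintro ⟨hne, hsU, hs⟩
    -- Among all `n`-faces, one with the largest intersection with `s` contains `s`.
    obtain ⟨S, hS, hmax⟩ : ∃ S, K.IsTopFace n S ∧
        ∀ S', K.IsTopFace n S' → (s ∩ S').card ≤ (s ∩ S).card := by
      have hfin : {S | K.IsTopFace n S}.Finite :=
        (U.powerset.finite_toSet).subset fun S hS => Finset.mem_powerset.2 (hall S hS).subset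
      exact Set.exists_max_image _ (fun S => (s ∩ S).card) hfin ⟨T, hT⟩
    have hB := hall S hS
    suffices hsS : s ⊆ S from (K.isRelLowerSet_faces hS.1).2 hsS hne
    intro v hv
    by_contra hvS
    obtain ⟨u, huU, hus, hcu⟩ := hs v (hsU hv)
    have huS : u ∈ S := by
      by_contra huS
      exact hus (hB.injOn u huU huS v (hsU hv) hvS hcu ▸ hv)
    obtain ⟨x, hx, hxS, -⟩ := hP.exists_unique_flip hS huS
    obtain ⟨hxU, hcx⟩ := hB.opposite u huS x hx hxS
    obtain rfl := hB.injOn x hxU hx v (hsU hv) hvS (hcx.trans hcu)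
    have hlt : s ∩ S ⊂ s ∩ insert x (S.erase u) := by
      refine (Finset.ssubset_iff_of_subset fun y hy => ?_).2
        ⟨x, Finset.mem_inter.2 ⟨hv, Finset.mem_insert_self _ _⟩,
          fun h => hvS (Finset.mem_inter.1 h).2⟩
      obtain ⟨hys, hyS⟩ := Finset.mem_inter.1 hy
      exact Finset.mem_inter.2 ⟨hys, Finset.mem_insert_of_mem
        (Finset.mem_erase.2 ⟨fun e => hus (e ▸ hys), hyS⟩)⟩
    exact absurd (hmax _ hxS) (not_le.2 (Finset.card_lt_card hlt))

end Blocks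

end PreAbstractSimplicialComplex

namespace PreAbstractSimplicialComplex

/-! ### Joins of boundaries of simplices are spheres -/

section Realization

variable {V : Type*} {K : PreAbstractSimplicialComplex V}

theorem continuous_simplexInclusion (s : K.faces) : Continuous (simplexInclusion K s) :=
  continuous_iff_coinduced_le.2 <|
    le_iSup (fun s : K.faces => TopologicalSpace.coinduced (simplexInclusion K s) inferInstance) s

theorem continuous_realization_dom {X : Type*} [TopologicalSpace X] {f : K.Realization → X} :
    Continuous f ↔ ∀ s, Continuous (f ∘ simplexInclusion K s) := by
  refine continuous_iSup_dom.trans (forall_congr' fun s => continuous_coinduced_dom)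

theorem isCompact_closedSimplex (s : Finset V) : IsCompact (closedSimplex s) := by
  refine (isCompact_univ_pi fun _ : V => isCompact_Icc (a := (0 : ℝ)) (b := 1)).of_isClosed_subset
    ?_ ?_
  · simp only [closedSimplex, Set.ofPred_and, Set.ofPred_forall]
    refine IsClosed.inter ?_ (IsClosed.inter ?_ ?_)
    · exact isClosed_iInter fun v => isClosed_le continuous_const (continuous_apply v)
    · exact isClosed_iInter fun v => isClosed_iInter fun _ =>
        isClosed_eq (continuous_apply v) continuous_const
    · exact isClosed_eq (by fun_prop) continuous_const
  · rintro x ⟨h0, hs, h1⟩ v -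
    refine ⟨h0 v, ?_⟩
    by_cases hv : v ∈ s
    · exact h1 ▸ Finset.single_le_sum (fun u _ => h0 u) hv
    · rw [hs v hv]
      exact zero_le_one

theorem compactSpace_realization (hK : K.faces.Finite) : CompactSpace K.Realization := by
  have := hK.to_subtype
  refine ⟨?_⟩
  have huniv : (Set.univ : Set K.Realization) = ⋃ s, Set.range (simplexInclusion K s) := by
    refine (Set.eq_univ_of_forall fun x => ?_).symm
    obtain ⟨s, hs, hx⟩ := Set.mem_iUnion₂.1 x.2
    exact Set.mem_iUnion.2 ⟨⟨s, hs⟩, ⟨x.1, hx⟩, rfl⟩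
  rw [huniv]
  refine isCompact_iUnion fun s => ?_
  have := isCompact_iff_compactSpace.1 (isCompact_closedSimplex (s : Finset V))
  exact isCompact_range (continuous_simplexInclusion s)

variable [DecidableEq V]

/-- The realization of a join of boundaries of simplices is a sphere. The join is given by the
finite set `T ∪ T.image c` of its vertices, partitioned into blocks, the fibres of `c`, each of them
containing exactly one vertex outside `T`. -/
theorem nonempty_homeomorph_sphere_of_blocks {n : ℕ} {T : Finset V} {c : V → V}
    (hT : T.card = n + 1) (hcT : ∀ v ∈ T, c v ∉ T) (hc : ∀ v ∉ T, c v = v)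
    (hK : ∀ s, s ∈ K.faces ↔ s.Nonempty ∧ s ⊆ T ∪ T.image c ∧
      ∀ v ∈ T ∪ T.image c, ∃ u ∈ T ∪ T.image c, u ∉ s ∧ c u = c v) :
    Nonempty (K.Realization ≃ₜ Metric.sphere (0 : EuclideanSpace ℝ (Fin (n + 1))) 1) := by
  set U := T ∪ T.image c with hU
  have hcU : ∀ v ∈ U, c v ∈ U ∧ c (c v) = c v := by
    intro v hv
    by_cases hvT : v ∈ T
    · exact ⟨Finset.mem_union_right _ (Finset.mem_image_of_mem _ hvT), hc _ (hcT v hvT)⟩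
    · rw [hc v hvT]
      exact ⟨hv, hc v hvT⟩
  -- In terms of barycentric coordinates: the support of a point contains no block.
  have hx : ∀ x : K.Realization, (∀ v, 0 ≤ x.1 v) ∧ (∀ v, v ∉ U → x.1 v = 0) ∧
      ∑ v ∈ U, x.1 v = 1 ∧ ∀ v ∈ U, ∃ u ∈ U, c u = c v ∧ x.1 u = 0 := by
    intro x
    obtain ⟨s, hs, h0, hxs, h1⟩ := Set.mem_iUnion₂.1 x.2
    obtain ⟨-, hsU, hs⟩ := (hK s).1 hs
    refine ⟨h0, fun v hv => hxs v fun h => hv (hsU h), ?_, fun v hv => ?_⟩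
    · rw [← h1]
      exact (Finset.sum_subset hsU fun v _ hv => hxs v hv).symm
    · obtain ⟨u, hu, hus, hcu⟩ := hs v hv
      exact ⟨u, hu, hcu, hxs u hus⟩
  let e : Fin (n + 1) ≃ T := (Finset.equivFinOfCardEq hT).symm
  let Φ : (V → ℝ) → EuclideanSpace ℝ (Fin (n + 1)) := fun x =>
    WithLp.toLp 2 fun i => x (e i) - x (c (e i))
  have hΦ : Continuous Φ := by
    refine (PiLp.continuous_toLp 2 _).comp ?_
    fun_prop
  have hΦT : ∀ {x y : V → ℝ} {a : ℝ}, Φ x = a • Φ y →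
      ∀ v ∈ T, x v - x (c v) = a * (y v - y (c v)) := by
    intro x y a h v hv
    have := congrArg (fun z : EuclideanSpace ℝ (Fin (n + 1)) => z (e.symm ⟨v, hv⟩)) h
    simpa [Φ] using this
  -- A point of `|K|` is determined up to scaling by the differences within the blocks.
  have hle : ∀ (x y : K.Realization) (a : ℝ), 0 ≤ a → Φ x.1 = a • Φ y.1 →
      ∀ v ∈ U, x.1 v = a * y.1 v := by
    intro x y a ha h
    have hd : ∀ v ∈ U, x.1 v - x.1 (c v) = a * (y.1 v - y.1 (c v)) := by
      intro v hv
      by_cases hvT : v ∈ T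
      · exact hΦT h v hvT
      · simp [hc v hvT]
    intro v hv
    obtain ⟨u, hu, hcu, hxu⟩ := (hx x).2.2.2 v hv
    obtain ⟨w, hw, hcw, hyw⟩ := (hx y).2.2.2 v hv
    have h1 := hd v hv
    have h2 := hd u hu
    have h3 := hd w hw
    rw [hcu, hxu] at h2
    rw [hcw, hyw] at h3
    have h4 := mul_nonneg ha ((hx y).1 u)
    have h5 := (hx x).1 w
    linarith
  have hΦ0 : ∀ x : K.Realization, Φ x.1 ≠ 0 := by
    intro x h
    have h1 := (hx x).2.2.1
    rw [Finset.sum_eq_zero fun v hv => ?_] at h1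
    · exact zero_ne_one h1
    · rw [hle x x 0 le_rfl (by rw [h, smul_zero]) v hv, zero_mul]
  let f : K.Realization → Metric.sphere (0 : EuclideanSpace ℝ (Fin (n + 1))) 1 := fun x =>
    ⟨‖Φ x.1‖⁻¹ • Φ x.1, by
      rw [mem_sphere_zero_iff_norm, norm_smul, norm_inv, norm_norm,
        inv_mul_cancel₀ (norm_ne_zero_iff.2 (hΦ0 x))]⟩
  have hf : Continuous f := by
    refine continuous_realization_dom.2 fun s => ?_
    have hs : Continuous fun x : closedSimplex (s : Finset V) => Φ x.1 :=
      hΦ.comp continuous_subtype_val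
    refine Continuous.subtype_mk (f := fun x : closedSimplex (s : Finset V) => ‖Φ x.1‖⁻¹ • Φ x.1)
      ?_ _
    exact (hs.norm.inv₀ fun x => norm_ne_zero_iff.2 (hΦ0 (simplexInclusion K s x))).smul hs
  have hinj : Function.Injective f := by
    intro x y hxy
    have hn := norm_pos_iff.2 (hΦ0 x)
    have hxy' : ‖Φ x.1‖⁻¹ • Φ x.1 = ‖Φ y.1‖⁻¹ • Φ y.1 := congrArg Subtype.val hxy
    have h : Φ x.1 = (‖Φ x.1‖ * ‖Φ y.1‖⁻¹) • Φ y.1 := by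
      rw [mul_smul, ← hxy', smul_smul, mul_inv_cancel₀ hn.ne', one_smul]
    have h1 := hle x y _ (by positivity) h
    have h2 : ‖Φ x.1‖ * ‖Φ y.1‖⁻¹ = 1 := by
      have h3 := (hx x).2.2.1
      rwa [Finset.sum_congr rfl h1, ← Finset.mul_sum, (hx y).2.2.1, mul_one] at h3
    refine Subtype.ext (funext fun v => ?_)
    by_cases hv : v ∈ U
    · rw [h1 v hv, h2, one_mul]
    · rw [(hx x).2.1 v hv, (hx y).2.1 v hv]
  have hsurj : Function.Surjective f := by
    intro y
    let z : V → ℝ := fun v => if hv : v ∈ T then y.1 (e.symm ⟨v, hv⟩) else 0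
    have hmin : ∀ p, ∃ m : ℝ, ∀ v ∈ U, c v = p →
        (∃ u ∈ U, c u = p ∧ z u = m) ∧ m ≤ z v := by
      intro p
      rcases (U.filter (c · = p)).eq_empty_or_nonempty with h | h
      · refine ⟨0, fun v hv hvp => ?_⟩
        exact absurd (Finset.mem_filter.2 ⟨hv, hvp⟩) (h ▸ Finset.notMem_empty v)
      · obtain ⟨u, hu, hum⟩ := Finset.exists_min_image _ z h
        obtain ⟨huU, hup⟩ := Finset.mem_filter.1 hu
        exact ⟨z u, fun v hv hvp => ⟨⟨u, huU, hup, rfl⟩, hum v (Finset.mem_filter.2 ⟨hv, hvp⟩)⟩⟩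
    choose m hm using hmin
    -- Shift each block so that its minimum becomes `0`; normalising yields a preimage of `y`.
    let w : V → ℝ := fun v => if v ∈ U then z v - m (c v) else 0
    have hw0 : ∀ v, 0 ≤ w v := by
      intro v
      by_cases hv : v ∈ U
      · simpa [w, hv] using ((hm _ v hv rfl).2)
      · simp [w, hv]
    have hΦw : Φ w = y.1 := by
      ext i
      have hiT : (e i : V) ∈ T := (e i).2
      have hiU : (e i : V) ∈ U := Finset.mem_union_left _ hiT
      simp [Φ, w, hiU, hcU _ hiU, z, hcT _ hiT]
    have hy : ‖y.1‖ = 1 := mem_sphere_zero_iff_norm.1 y.2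
    have hσ : 0 < ∑ v ∈ U, w v := by
      refine (Finset.sum_nonneg fun v _ => hw0 v).lt_of_ne fun h => ?_
      have hw : w = 0 := by
        funext v
        by_cases hv : v ∈ U
        · exact (Finset.sum_eq_zero_iff_of_nonneg fun v _ => hw0 v).1 h.symm v hv
        · simp [w, hv]
      have : y.1 = 0 := by
        rw [← hΦw, hw]
        ext i
        simp [Φ]
      rw [this, norm_zero] at hy
      exact zero_ne_one hy
    set σ := ∑ v ∈ U, w v with hσdef
    have hsum : ∑ v ∈ U.filter (w · ≠ 0), w v = σ := by
      rw [Finset.sum_filter_ne_zero]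
    have hface : U.filter (w · ≠ 0) ∈ K.faces := by
      refine (hK _).2 ⟨Finset.nonempty_of_sum_ne_zero (hsum ▸ hσ.ne'), Finset.filter_subset _ _,
        fun v hv => ?_⟩
      obtain ⟨u, hu, hcu, hzu⟩ := (hm _ v hv rfl).1
      refine ⟨u, hu, fun h => (Finset.mem_filter.1 h).2 ?_, hcu⟩
      simp [w, hu, hzu, hcu]
    have hmem : σ⁻¹ • w ∈ closedSimplex (U.filter (w · ≠ 0)) := by
      refine ⟨fun v => mul_nonneg (inv_nonneg.2 hσ.le) (hw0 v), fun v hv => ?_, ?_⟩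
      · have : w v = 0 := by
          by_contra h
          refine hv (Finset.mem_filter.2 ⟨?_, h⟩)
          by_contra hvU
          exact h (if_neg hvU)
        simp [this]
      · simp only [Pi.smul_apply, smul_eq_mul]
        rw [← Finset.mul_sum, hsum, inv_mul_cancel₀ hσ.ne']
    refine ⟨simplexInclusion K ⟨_, hface⟩ ⟨_, hmem⟩, Subtype.ext ?_⟩
    have hΦσ : Φ (σ⁻¹ • w) = σ⁻¹ • y.1 := by
      rw [← hΦw]
      ext i
      simp [Φ, mul_sub]
    change ‖Φ (σ⁻¹ • w)‖⁻¹ • Φ (σ⁻¹ • w) = y.1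
    rw [hΦσ, norm_smul, hy, mul_one, Real.norm_of_nonneg (inv_nonneg.2 hσ.le), inv_inv, smul_smul,
      mul_inv_cancel₀ hσ.ne', one_smul]
  have : CompactSpace K.Realization := compactSpace_realization <|
    U.powerset.finite_toSet.subset fun s hs => Finset.mem_powerset.2 ((hK s).1 hs).2.1
  exact ⟨Continuous.homeoOfEquivCompactToT2 (f := Equiv.ofBijective f ⟨hinj, hsurj⟩) hf⟩

end Realization

end PreAbstractSimplicialComplex

theorem theorem2p3 {V : Type*} [DecidableEq V] (n : ℕ) (K : PreAbstractSimplicialComplex V)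
    (hK : K.IsOfType n {3, 4}) :
    Nonempty (K.Realization ≃ₜ Metric.sphere (0 : EuclideanSpace ℝ (Fin (n + 1))) 1) := by
  obtain ⟨T, c, hT, hcT, hc, hfaces⟩ := hK.exists_blocks
  exact PreAbstractSimplicialComplex.nonempty_homeomorph_sphere_of_blocks hT hcT hc hfaces
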